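/- Let $n,N\ge 0$ be integers and let $\lambda=(\lambda_1,\dots,\lambda_N)\in\mathbb Z_{\ge0}^N$ with $\lambda_1+\dots+\lambda_N=n$. Put $\lambda^{(k)}=\lambda_1+\dots+\lambda_k$ and $\lambda^{\{1\}}=\lambda^{(1)}+\dots+\lambda^{(N-1)}$. Let $\mathcal I_\lambda$ be the set of partitions $I=(I_1,\dots,I_N)$ of $\{1,\dots,n\}$ with $|I_k|=\lambda_k$, and for $I\in\mathcal I_\lambda$ write $I_1\cup\dots\cup I_k=\{i^{(k)}_1<\dots<i^{(k)}_{\lambda^{(k)}}\}$. A wall in $\mathbb R^N$ is a hyperplane $\nu_j-\nu_i=m$ with $1\le i<j\le N$, $m\in\mathbb Z$; an alcove is a connected component of the complement of the union of all walls. Let $\Delta$ be an alcove, $\nu\in\Delta$, and let $m_{i,j}=\lfloor\nu_j-\nu_i\rfloor$ for $i<j$ (these integers depend only on $\Delta$). Take variables $h$, $\boldsymbol z=(z_1,\dots,z_n)$ and $\boldsymbol t=(t^{(k)}_a)_{1\le k\le N-1,\ 1\le a\le\lambda^{(k)}}$, and set $t^{(N)}_a=z_a$. For $I\in\mathcal I_\lambda$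 define the trigonometric weight function $$W^\Delta_I(\boldsymbol t,\boldsymbol z,h)=(1-h)^{\lambda^{\{1\}}}\,\mathrm{Sym}_{t^{(1)}}\cdots\mathrm{Sym}_{t^{(N-1)}}\ \prod_{k=1}^{N-1}\prod_{a=1}^{\lambda^{(k)}}\Bigl(\prod_{c=1}^{\lambda^{(k+1)}}\psi_{I,k,a,c}\bigl(t^{(k+1)}_c/t^{(k)}_a\bigr)\prod_{b=a+1}^{\lambda^{(k)}}\frac{1-h\,t^{(k)}_b/t^{(k)}_a}{1-t^{(k)}_b/t^{(k)}_a}\Bigr),$$ where $\mathrm{Sym}_{t^{(k)}}$ is the sum over all permutations of the variables $t^{(k)}_1,\dots,t^{(k)}_{\lambda^{(k)}}$, and $\psi_{I,k,a,c}(x)$ equals $1-hx$ if $i^{(k+1)}_c<i^{(k)}_a$, equals $x^{-m_{j,k+1}}$ with $j$ determined by $i^{(k)}_a\in I_j$ if $i^{(k+1)}_c=i^{(k)}_a$, and equals $1-x$ if $i^{(k+1)}_c>i^{(k)}_a$. For $J\in\mathcal I_\lambda$ with $J_1\cup\dots\cup J_k=\{j^{(k)}_1<\dots<j^{(k)}_{\lambda^{(k)}}\}$,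 let $W^\Delta_I(\boldsymbol z_J,\boldsymbol z,h)$ be the result of the substitution $t^{(k)}_a=z_{j^{(k)}_a}$ for all $k$ and $a$, and put $S_I(\boldsymbol z)=\prod_{k=1}^N\prod_{a\in I_k}z_a^{-\nu_k}$, a monomial with real exponents. Then for all $I,J\in\mathcal I_\lambda$ the function $W^\Delta_I(\boldsymbol z_J,\boldsymbol z,h)$ is a Laurent polynomial, that is, an element of $\mathbb C[z_1^{\pm1},\dots,z_n^{\pm1},h^{\pm1}]$, and $$\mathcal N\bigl(W^\Delta_I(\boldsymbol z_J,\boldsymbol z,h)\cdot S_I(\boldsymbol z)\bigr)\subset\mathcal N\bigl(W^\Delta_J(\boldsymbol z_J,\boldsymbol z,h)\cdot S_J(\boldsymbol z)\bigr).$$ Here, for a finite sum $f$ of monomials in $\boldsymbol z$ with real exponents and coefficients in $\mathbb C[h^{\pm1}]$, the Newton polytope $\mathcal N(f)\subset\mathbb R^n$ is the convex hull of the exponents $(k_1,\dots,k_n)$ of the monomials $z_1^{k_1}\cdots z_n^{k_n}$ whose coefficient in $f$ is a nonzero element of $\mathbb C[h^{\pm1}]$. -/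

import Mathlib

namespace TrigWeight

/-! Indices are zero-based: the block `I_k`, the coordinate `ν_k` and the number `λ_k` of the usual
one-based notation (`k = 1, …, N`) carry the index `k - 1 : Fin N`, and `{1, …, n}` is `Fin n`. -/

/-- A wall is a hyperplane `x_j - x_i = m` with `i < j` and `m` an integer. This is the union of
all the walls in `ℝ^N`. -/
def wallUnion (N : ℕ) : Set (Fin N → ℝ) :=
  {x | ∃ i j : Fin N, i < j ∧ ∃ m : ℤ, x j - x i = m}

/-- An alcove is a connected component of the complement of the union of all walls. -/
def IsAlcove {N : ℕ} (Δ : Set (Fin N → ℝ)) : Prop :=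
  ∃ x ∈ (wallUnion N)ᶜ, Δ = connectedComponentIn (wallUnion N)ᶜ x

/-- The integer characteristic `m_{i,j}` of an alcove `Δ` (for `i < j`): the common value of
`⌊ν_j - ν_i⌋` for `ν ∈ Δ`, see `intChar_eq_floor`. -/
noncomputable def intChar {N : ℕ} (Δ : Set (Fin N → ℝ)) (i j : Fin N) : ℤ :=
  sInf ((fun ν : Fin N → ℝ => ⌊ν j - ν i⌋) '' Δ)

theorem floor_le_of_mem_alcove {N : ℕ} {Δ : Set (Fin N → ℝ)} (hΔ : IsAlcove Δ)
    {x y : Fin N → ℝ} (hx : x ∈ Δ) (hy : y ∈ Δ) {i j : Fin N} (hij : i < j) :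
    ⌊x j - x i⌋ ≤ ⌊y j - y i⌋ := by
  obtain ⟨p, -, rfl⟩ := hΔ
  have hc : IsPreconnected ((fun ν : Fin N → ℝ => ν j - ν i) ''
      connectedComponentIn (wallUnion N)ᶜ p) :=
    isPreconnected_connectedComponentIn.image _ (by fun_prop)
  by_contra! hlt
  have h1 : y j - y i ≤ (⌊x j - x i⌋ : ℝ) := (Int.floor_lt.mp hlt).le
  obtain ⟨w, hw, hwe⟩ := hc.ordConnected.out (Set.mem_image_of_mem _ hy)
    (Set.mem_image_of_mem _ hx) ⟨h1, Int.floor_le _⟩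
  exact connectedComponentIn_subset _ _ hw ⟨i, j, hij, _, hwe⟩

/-- The integer characteristics depend on the alcove only, and are the integer parts of the
differences `ν_j - ν_i` for any point `ν` of the alcove. -/
theorem intChar_eq_floor {N : ℕ} {Δ : Set (Fin N → ℝ)} (hΔ : IsAlcove Δ)
    {ν : Fin N → ℝ} (hν : ν ∈ Δ) {i j : Fin N} (hij : i < j) :
    intChar Δ i j = ⌊ν j - ν i⌋ := by
  have : (fun ν : Fin N → ℝ => ⌊ν j - ν i⌋) '' Δ = {⌊ν j - ν i⌋} := by
    ext m
    constructor
    · rintro ⟨x, hx, rfl⟩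
      exact le_antisymm (floor_le_of_mem_alcove hΔ hx hν hij)
        (floor_le_of_mem_alcove hΔ hν hx hij)
    · rintro rfl
      exact ⟨ν, hν, rfl⟩
  rw [intChar, this, csInf_singleton]

/-- `I_λ`: the set of ordered partitions `I = (I_1, …, I_N)` of `{1, …, n}` into (possibly empty)
blocks with `|I_k| = λ_k`. A partition is stored as the map sending each element to the index of
its block. -/
structure IndexSet {N : ℕ} (n : ℕ) (lam : Fin N → ℕ) where
  /-- `blockOf a = k` means that `a ∈ I_k` -/
  blockOf : Fin n → Fin N
  card_block : ∀ k, (Finset.univ.filter fun a => blockOf a = k).card = lam k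

/-- The partial sum `λ^{(k)} = λ_1 + ⋯ + λ_k`. -/
def partialSum {N : ℕ} (lam : Fin N → ℕ) (k : ℕ) : ℕ :=
  ∑ j ∈ Finset.univ.filter (fun j : Fin N => j.val < k), lam j

namespace IndexSet

variable {N n : ℕ} {lam : Fin N → ℕ}

/-- The block `I_k`. -/
def block (I : IndexSet n lam) (k : Fin N) : Finset (Fin n) :=
  Finset.univ.filter fun a => I.blockOf a = k

/-- The union `I_1 ∪ ⋯ ∪ I_k` of the first `k` blocks. -/
def firstBlocks (I : IndexSet n lam) (k : ℕ) : Finset (Fin n) :=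
  Finset.univ.filter fun a => (I.blockOf a).val < k

theorem card_firstBlocks (I : IndexSet n lam) (k : ℕ) :
    (I.firstBlocks k).card = partialSum lam k := by
  rw [partialSum, Finset.card_eq_sum_card_fiberwise (f := I.blockOf)
    (t := Finset.univ.filter (fun j : Fin N => j.val < k))]
  · refine Finset.sum_congr rfl fun j hj => ?_
    rw [← I.card_block j]
    congr 1
    ext a
    simp only [Finset.mem_filter, Finset.mem_univ, true_and] at hj
    simp only [firstBlocks, Finset.mem_filter, Finset.mem_univ, true_and, and_iff_right_iff_imp]
    rintro rfl
    exact hj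
  · intro a ha
    simpa [firstBlocks] using ha

/-- The increasing enumeration `i^{(k)}_1 < ⋯ < i^{(k)}_{λ^{(k)}}` of `I_1 ∪ ⋯ ∪ I_k`. -/
def enum (I : IndexSet n lam) (k : ℕ) (a : Fin (partialSum lam k)) : Fin n :=
  (I.firstBlocks k).orderEmbOfFin (I.card_firstBlocks k) a

/-- `i^{(N)}_a = a`. -/
theorem enum_top (I : IndexSet n lam) (a : Fin (partialSum lam N)) :
    (I.enum N a).val = a.val := by
  have hu : I.firstBlocks N = Finset.univ := by
    ext a; simp [firstBlocks]
  have hn : partialSum lam N = n := by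
    rw [← I.card_firstBlocks N, hu, Finset.card_univ, Fintype.card_fin]
  have key := Finset.orderEmbOfFin_unique (I.card_firstBlocks N)
    (f := fun b => Fin.cast hn b) (by simp [hu]) (by intro b c hbc; exact hbc)
  have := congrFun key a
  rw [enum, ← this]
  rfl

end IndexSet

section WeightFunction

variable {N n : ℕ} {lam : Fin N → ℕ} {K : Type*} [Field K]

/-- The factor `ψ^Δ_{I,k,a,c}(x)` for `1 ≤ k ≤ N - 1`. Here `k : Fin N` has the value of the
one-based level `k`, so that as a zero-based block index `k` names the block `I_{k+1}`. The index
`j(I,k,a)` is that of the block containing `i^{(k)}_a`. -/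
noncomputable def psi (Δ : Set (Fin N → ℝ)) (h : K) (I : IndexSet n lam) (k : Fin N)
    (a : Fin (partialSum lam k)) (c : Fin (partialSum lam (k.val + 1))) (x : K) : K :=
  if I.enum (k.val + 1) c < I.enum k a then 1 - h * x
  else if I.enum (k.val + 1) c = I.enum k a then x ^ (-intChar Δ (I.blockOf (I.enum k a)) k)
  else 1 - x

/-- The product `U^Δ_I`, as a function of the values of all the variables `t^{(k)}_a`, where
`t^{(N)} = z`. The levels are `k = 1, …, N - 1`; the value `k = 0` contributes an empty product,
as `λ^{(0)} = 0`. -/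
noncomputable def U (Δ : Set (Fin N → ℝ)) (h : K) (I : IndexSet n lam)
    (t : (k : ℕ) → Fin (partialSum lam k) → K) : K :=
  ∏ k : Fin N, ∏ a : Fin (partialSum lam k),
    ((∏ c : Fin (partialSum lam (k.val + 1)), psi Δ h I k a c (t (k.val + 1) c / t k a)) *
      ∏ b ∈ Finset.univ.filter (fun b => a < b), (1 - h * (t k b / t k a)) / (1 - t k b / t k a))

/-- Permuting the variables `t^{(k)}_a` within each level `k < N`, and keeping `t^{(N)} = z`. -/
def permute (s : (k : Fin N) → Equiv.Perm (Fin (partialSum lam k)))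
    (t : (k : ℕ) → Fin (partialSum lam k) → K) : (k : ℕ) → Fin (partialSum lam k) → K :=
  fun k a => if hk : k < N then t k (s ⟨k, hk⟩ a) else t k a

/-- The trigonometric weight function
`W^Δ_I(t, z, h) = (1 - h)^{λ^{(1)} + ⋯ + λ^{(N-1)}} Sym_{t^{(1)}} ⋯ Sym_{t^{(N-1)}} U^Δ_I`,
with `z = t^{(N)}`. The level `0` is empty: it adds `λ^{(0)} = 0` to the exponent, and a
symmetrization in no variables. -/
noncomputable def W (Δ : Set (Fin N → ℝ)) (h : K) (I : IndexSet n lam)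
    (t : (k : ℕ) → Fin (partialSum lam k) → K) : K :=
  (1 - h) ^ (∑ k : Fin N, partialSum lam k) *
    ∑ s : (k : Fin N) → Equiv.Perm (Fin (partialSum lam k)), U Δ h I (permute s t)

end WeightFunction

/-- The ring `ℂ[z_1^{±1}, …, z_n^{±1}, h^{±1}]`, as Laurent polynomials in `z` with coefficients in
the ring `ℂ[h^{±1}]`. -/
abbrev LaurentRing (n : ℕ) : Type := AddMonoidAlgebra (LaurentPolynomial ℂ) (Fin n → ℤ)

/-- Finite sums of monomials in `z_1, …, z_n` with real exponents and coefficients in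
`ℂ[h^{±1}]`. -/
abbrev RealExpRing (n : ℕ) : Type := AddMonoidAlgebra (LaurentPolynomial ℂ) (Fin n → ℝ)

/-- The field `ℂ(z_1, …, z_n, h)` of rational functions. -/
abbrev RatFun (n : ℕ) : Type := FractionRing (LaurentRing n)

/-- The variable `z_a`, as a rational function. -/
noncomputable def zVar {n : ℕ} (a : Fin n) : RatFun n :=
  algebraMap (LaurentRing n) (RatFun n) (AddMonoidAlgebra.single (Pi.single a 1) 1)

/-- The variable `h`, as a rational function. -/
noncomputable def hVar (n : ℕ) : RatFun n :=
  algebraMap (LaurentRing n) (RatFun n) (AddMonoidAlgebra.single 0 (LaurentPolynomial.T 1))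

/-- The evaluation `W^Δ_I(z_J, z, h)`: the substitution `t^{(k)}_a = z_{j^{(k)}_a}`,
`k = 1, …, N`. The denominators of `W^Δ_I` do not vanish under it. -/
noncomputable def evalW {N n : ℕ} {lam : Fin N → ℕ} (Δ : Set (Fin N → ℝ))
    (I J : IndexSet n lam) : RatFun n :=
  W Δ (hVar n) I (fun k a => zVar (J.enum k a))

/-- A Laurent polynomial regarded as a sum of monomials with real exponents. -/
noncomputable def toRealExp {n : ℕ} (f : LaurentRing n) : RealExpRing n :=
  AddMonoidAlgebra.mapDomain (fun (v : Fin n → ℤ) (a : Fin n) => (v a : ℝ)) f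

/-- `S_I = ∏_k ∏_{a ∈ I_k} z_a^{-ν_k}`. -/
noncomputable def S {N n : ℕ} {lam : Fin N → ℕ} (ν : Fin N → ℝ) (I : IndexSet n lam) :
    RealExpRing n :=
  ∏ k : Fin N, ∏ a ∈ I.block k, AddMonoidAlgebra.single (Pi.single a (-ν k)) 1

/-- The Newton polytope in the variables `z`: the convex hull of the exponents whose coefficient,
a Laurent polynomial in `h`, is nonzero. -/
def newtonPolytope {n : ℕ} (f : RealExpRing n) : Set (Fin n → ℝ) :=
  convexHull ℝ {v | f.coeff v ≠ 0}

end TrigWeight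

/-! Fix a direction `l` in the space of exponents and measure Laurent polynomials by their
`l`-degree, the maximum of `l` on the support in `z`. By separation of a point from a polytope
(`newtonPolytope_subset`), it suffices to compare `l`-degrees for every real `l`, the factors `S ν
I` and `S ν J` only shifting them.

Integrality: multiplying a term by its sign and a monomial turns its denominator into the product of
the Vandermonde determinants of all levels, which is the same for every term. The symmetrization
thus becomes an antisymmetrization of Laurent polynomials, which that product divides
(`prod_vandermonde_dvd_antisymm`).

Upper bound: `1 - h t_b/t_a` and `1 - t_b/t_a` have equal `l`-degree, so only the `psi` factors
count. Were they all binomials, their degrees `max 0 (l q - l p)` would sum to `diagDeg l J`,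
independently of the permutations. A monomial factor has degree `-m * (l q - l p)` instead, and `m ≤
ν_k - ν_j ≤ m + 1` bounds this by `max 0 (l q - l p) - (ν_k - ν_j) * (l q - l p)`. Summation by
parts over the levels (`sum_levels_eq`) turns the total correction into the difference of the
`l`-degrees of `S ν I` and `S ν J` (`sum_psiDeg_le`).

Sharpness for `I = J`: only the identity permutations contribute (`numTerm_self_eq_zero`), and there
every factor has an exact degree, with total `diagDeg l J`. -/

namespace TrigWeight

/-! ### Divisibility of antisymmetrized Laurent polynomials by Vandermonde determinants -/

section Antisymmetrization

variable {A : Type*} [CommRing A]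

-- Reduce `X ^ e i` modulo `∏ (X - x j)`: the values at the `x j` do not change and the remainder
-- has degree below `m`, so the matrix is one of remainder coefficients times a transposed
-- Vandermonde matrix. This needs neither distinct `x j` nor unique factorization.
open Polynomial in
theorem det_vandermonde_dvd_det_pow {m : ℕ} (x : Fin m → A) (e : Fin m → ℕ) :
    (Matrix.vandermonde x).det ∣ (Matrix.of fun i j => x j ^ e i).det := by
  nontriviality A
  set g : A[X] := ∏ i, (X - C (x i)) with hg
  have hmon : g.Monic := monic_prod_of_monic _ _ fun i _ => monic_X_sub_C _
  have hdeg : g.natDegree = m := by simp [hg]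
  have key : (Matrix.of fun i j => x j ^ e i) =
      (Matrix.of fun i l : Fin m => ((X ^ e i : A[X]) %ₘ g).coeff l) *
        (Matrix.vandermonde x).transpose := by
    ext i j
    have h0 : g.eval (x j) = 0 := by
      rw [hg, eval_prod]
      exact Finset.prod_eq_zero (Finset.mem_univ j) (by simp)
    have h1 : ((X ^ e i : A[X]) %ₘ g).eval (x j) = x j ^ e i := by
      have := congrArg (eval (x j)) (modByMonic_add_div (X ^ e i : A[X]) g)
      simpa [h0] using this
    have h2 : ((X ^ e i : A[X]) %ₘ g).degree < m := by
      rw [← hdeg, ← degree_eq_natDegree hmon.ne_zero]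
      exact degree_modByMonic_lt _ hmon
    rw [Matrix.of_apply, ← h1, eval_eq_sum_degreeLTEquiv (n := m) (mem_degreeLT.2 h2)]
    simp [Matrix.mul_apply, degreeLTEquiv]
  rw [key, Matrix.det_mul, Matrix.det_transpose]
  exact dvd_mul_left _ _

theorem det_vandermonde_dvd_det_zpow {m : ℕ} (u : Fin m → Aˣ) (e : Fin m → ℤ) :
    (Matrix.vandermonde fun a => (u a : A)).det ∣
      (Matrix.of fun i j => ((u j ^ e i : Aˣ) : A)).det := by
  -- A shift large enough to make every exponent nonnegative; it multiplies the determinant by a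
  -- unit.
  set M : ℤ := ∑ i, |e i|
  have hM : ∀ i, 0 ≤ e i + M := fun i => by
    have : |e i| ≤ M := Finset.single_le_sum (f := fun i => |e i|) (fun _ _ => abs_nonneg _)
      (Finset.mem_univ i)
    linarith [neg_abs_le (e i)]
  have key : (Matrix.of fun i j => ((u j ^ e i : Aˣ) : A)).det * ((∏ j, u j ^ M : Aˣ) : A) =
      (Matrix.of fun i j => (u j : A) ^ (e i + M).toNat).det := by
    rw [mul_comm, Units.coe_prod, ← Matrix.det_mul_row]
    congr 1
    ext i j
    simp only [Matrix.of_apply]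
    rw [← Units.val_mul, ← zpow_add, add_comm M, ← Units.val_pow_eq_pow_val, ← zpow_natCast,
      Int.toNat_of_nonneg (hM i)]
  rw [← Units.dvd_mul_right, key]
  exact det_vandermonde_dvd_det_pow _ _

variable {ι : Type*} {m : ι → ℕ}

/-- The Laurent polynomial functions of the permuted variables `u_k(s_k(a))`. -/
def permLaurent (u : ∀ k, Fin (m k) → Aˣ) :
    Subalgebra A ((∀ k, Equiv.Perm (Fin (m k))) → A) :=
  Algebra.adjoin A (⋃ k, ⋃ a, {(fun s => ((u k (s k a) : Aˣ) : A)),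
    (fun s => (((u k (s k a))⁻¹ : Aˣ) : A))})

theorem val_mem_permLaurent (u : ∀ k, Fin (m k) → Aˣ) (k : ι) (a : Fin (m k)) :
    (fun s => ((u k (s k a) : Aˣ) : A)) ∈ permLaurent u :=
  Algebra.subset_adjoin (Set.mem_iUnion.2 ⟨k, Set.mem_iUnion.2 ⟨a, Or.inl rfl⟩⟩)

theorem inv_mem_permLaurent (u : ∀ k, Fin (m k) → Aˣ) (k : ι) (a : Fin (m k)) :
    (fun s => (((u k (s k a))⁻¹ : Aˣ) : A)) ∈ permLaurent u :=
  Algebra.subset_adjoin (Set.mem_iUnion.2 ⟨k, Set.mem_iUnion.2 ⟨a, Or.inr rfl⟩⟩)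

variable [Fintype ι] [DecidableEq ι]

/-- By linearity `F` may be taken to be a monomial; its antisymmetrization is then a product over
`k` of generalized Vandermonde determinants. -/
theorem prod_vandermonde_dvd_antisymm (u : ∀ k, Fin (m k) → Aˣ)
    {F : (∀ k, Equiv.Perm (Fin (m k))) → A} (hF : F ∈ permLaurent u) :
    (∏ k, (Matrix.vandermonde fun a => (u k a : A)).det) ∣
      ∑ s : ∀ k, Equiv.Perm (Fin (m k)), (∏ k, ((Equiv.Perm.sign (s k) : ℤ) : A)) * F s := by
  have hmono : ∀ G ∈ Submonoid.closure (⋃ k, ⋃ a, {(fun s => ((u k (s k a) : Aˣ) : A)),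
      (fun s => (((u k (s k a))⁻¹ : Aˣ) : A))} : Set ((∀ k, Equiv.Perm (Fin (m k))) → A)),
      ∃ e : ∀ k, Fin (m k) → ℤ, G = fun s => ∏ k, ∏ a, ((u k (s k a) ^ e k a : Aˣ) : A) := by
    intro G hG
    induction hG using Submonoid.closure_induction with
    | mem G hG =>
      obtain ⟨k, hG⟩ := Set.mem_iUnion.1 hG
      obtain ⟨a, hG⟩ := Set.mem_iUnion.1 hG
      have aux : ∀ (c : ℤ) (s : ∀ k, Equiv.Perm (Fin (m k))), ∏ k', ∏ a',
          ((u k' (s k' a') ^ ((Pi.single k (Pi.single a c) : ∀ k, Fin (m k) → ℤ) k' a') : Aˣ) : A)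
          = ((u k (s k a) ^ c : Aˣ) : A) := by
        intro c s
        rw [Finset.prod_eq_single k, Finset.prod_eq_single a]
        · simp
        · intro b _ hb; simp [hb]
        · simp
        · intro b _ hb; simp [hb]
        · simp
      rcases hG with rfl | rfl
      · exact ⟨Pi.single k (Pi.single a 1), funext fun s => by rw [aux]; simp⟩
      · exact ⟨Pi.single k (Pi.single a (-1)), funext fun s => by rw [aux]; simp⟩
    | one => exact ⟨0, by ext; simp⟩
    | mul G H _ _ hG hH =>
      obtain ⟨e, rfl⟩ := hG
      obtain ⟨e', rfl⟩ := hH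
      refine ⟨e + e', ?_⟩
      ext s
      simp only [Pi.mul_apply, Pi.add_apply, zpow_add, Units.val_mul, Finset.prod_mul_distrib]
  rw [permLaurent, ← Subalgebra.mem_toSubmodule, Algebra.adjoin_eq_span] at hF
  induction hF using Submodule.span_induction with
  | mem G hG =>
    obtain ⟨e, rfl⟩ := hmono G hG
    -- Expand each determinant by the Leibniz formula; the product of the sums is a sum over
    -- families of permutations.
    have : ∑ s : ∀ k, Equiv.Perm (Fin (m k)), (∏ k, ((Equiv.Perm.sign (s k) : ℤ) : A)) *
        ∏ k, ∏ a, ((u k (s k a) ^ e k a : Aˣ) : A) =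
        ∏ k, (Matrix.of fun i j => ((u k j ^ e k i : Aˣ) : A)).det := by
      simp_rw [← Matrix.det_transpose (Matrix.of _), Matrix.det_apply', Finset.prod_univ_sum,
        Fintype.piFinset_univ, ← Finset.prod_mul_distrib]
      rfl
    rw [this]
    exact Finset.prod_dvd_prod_of_dvd _ _ fun k _ => det_vandermonde_dvd_det_zpow _ _
  | zero => simp
  | add F G _ _ hF hG =>
    simp only [Pi.add_apply, mul_add, Finset.sum_add_distrib]
    exact dvd_add hF hG
  | smul c F _ hF =>
    simp only [Pi.smul_apply, smul_eq_mul, mul_left_comm _ c, ← Finset.mul_sum]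
    exact hF.mul_left c

end Antisymmetrization

/-! ### Degrees of Laurent polynomials with respect to a linear functional -/

section Degree

open AddMonoidAlgebra

variable {R G : Type*} [CommRing R] [AddCommGroup G] {ℓ : G →+ ℝ}

/-- All exponents of `f` lie in the half-space `ℓ ≤ c`. -/
def DegLE (ℓ : G →+ ℝ) (f : AddMonoidAlgebra R G) (c : ℝ) : Prop :=
  ∀ v, f.coeff v ≠ 0 → ℓ v ≤ c

/-- Multiplication by `g` raises the `ℓ`-degree by exactly `d`. -/
def HasDeg (ℓ : G →+ ℝ) (g : AddMonoidAlgebra R G) (d : ℝ) : Prop :=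
  ∀ f c, DegLE ℓ (g * f) (c + d) ↔ DegLE ℓ f c

theorem DegLE.mono {f : AddMonoidAlgebra R G} {c d : ℝ} (hf : DegLE ℓ f c) (h : c ≤ d) :
    DegLE ℓ f d := fun v hv => (hf v hv).trans h

theorem DegLE.zero (c : ℝ) : DegLE ℓ (0 : AddMonoidAlgebra R G) c := fun v hv => by simp at hv

theorem DegLE.single (v : G) (r : R) : DegLE ℓ (single v r) (ℓ v) := fun w hw => by
  rw [coeff_single] at hw
  obtain rfl : v = w := by
    by_contra h
    exact hw (Finsupp.single_eq_of_ne (Ne.symm h))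
  exact le_rfl

theorem DegLE.one : DegLE ℓ (1 : AddMonoidAlgebra R G) 0 := by
  simpa [one_def] using DegLE.single (ℓ := ℓ) (0 : G) (1 : R)

theorem DegLE.add {f g : AddMonoidAlgebra R G} {c : ℝ} (hf : DegLE ℓ f c) (hg : DegLE ℓ g c) :
    DegLE ℓ (f + g) c := fun v hv => by
  by_cases h : f.coeff v = 0
  · exact hg v fun h' => hv (by simp [h, h'])
  · exact hf v h

theorem DegLE.neg {f : AddMonoidAlgebra R G} {c : ℝ} (hf : DegLE ℓ f c) : DegLE ℓ (-f) c :=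
  fun v hv => hf v fun h => hv (by simp [h])

theorem DegLE.mul {f g : AddMonoidAlgebra R G} {c d : ℝ} (hf : DegLE ℓ f c) (hg : DegLE ℓ g d) :
    DegLE ℓ (f * g) (c + d) := fun v hv => by
  classical
  obtain ⟨a, ha, b, hb, rfl⟩ := Finset.mem_add.1
    (support_coeff_mul_subset f g (Finsupp.mem_support_iff.2 hv))
  rw [map_add]
  exact add_le_add (hf a (Finsupp.mem_support_iff.1 ha)) (hg b (Finsupp.mem_support_iff.1 hb))

theorem DegLE.sum {ι : Type*} (s : Finset ι) {f : ι → AddMonoidAlgebra R G} {c : ℝ}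
    (hf : ∀ i ∈ s, DegLE ℓ (f i) c) : DegLE ℓ (∑ i ∈ s, f i) c :=
  Finset.sum_induction f (DegLE ℓ · c) (fun _ _ => DegLE.add) (DegLE.zero c) hf

theorem DegLE.prod {ι : Type*} (s : Finset ι) {f : ι → AddMonoidAlgebra R G} {c : ι → ℝ}
    (hf : ∀ i ∈ s, DegLE ℓ (f i) (c i)) : DegLE ℓ (∏ i ∈ s, f i) (∑ i ∈ s, c i) := by
  classical
  induction s using Finset.induction_on with
  | empty => simpa using DegLE.one
  | insert i s hi ih =>
    rw [Finset.prod_insert hi, Finset.sum_insert hi]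
    exact (hf i (Finset.mem_insert_self _ _)).mul
      (ih fun j hj => hf j (Finset.mem_insert_of_mem hj))

theorem DegLE.le_of_one [Nontrivial R] {c : ℝ} (h : DegLE ℓ (1 : AddMonoidAlgebra R G) c) :
    0 ≤ c := by
  simpa using h 0 (by simp [one_def])

theorem HasDeg.mul {f g : AddMonoidAlgebra R G} {c d : ℝ} (hf : HasDeg ℓ f c)
    (hg : HasDeg ℓ g d) : HasDeg ℓ (f * g) (c + d) := fun p e => by
  rw [mul_assoc, show e + (c + d) = e + d + c by ring, hf, hg]

theorem HasDeg.one : HasDeg ℓ (1 : AddMonoidAlgebra R G) 0 := fun p e => by simp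

theorem HasDeg.prod {ι : Type*} (s : Finset ι) {f : ι → AddMonoidAlgebra R G} {c : ι → ℝ}
    (hf : ∀ i ∈ s, HasDeg ℓ (f i) (c i)) : HasDeg ℓ (∏ i ∈ s, f i) (∑ i ∈ s, c i) := by
  classical
  induction s using Finset.induction_on with
  | empty => simpa using HasDeg.one
  | insert i s hi ih =>
    rw [Finset.prod_insert hi, Finset.sum_insert hi]
    exact (hf i (Finset.mem_insert_self _ _)).mul
      (ih fun j hj => hf j (Finset.mem_insert_of_mem hj))

theorem HasDeg.pow {f : AddMonoidAlgebra R G} (hf : HasDeg ℓ f 0) (k : ℕ) :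
    HasDeg ℓ (f ^ k) 0 := by
  simpa using HasDeg.prod (Finset.range k) (f := fun _ => f) (c := fun _ => 0) fun _ _ => hf

theorem HasDeg.degLE {g : AddMonoidAlgebra R G} {d : ℝ} (hg : HasDeg ℓ g d) : DegLE ℓ g d := by
  simpa using (hg 1 0).2 DegLE.one

theorem HasDeg.le_of_degLE [Nontrivial R] {g : AddMonoidAlgebra R G} {c d : ℝ}
    (hg : HasDeg ℓ g d) (h : DegLE ℓ g c) : d ≤ c := by
  have := DegLE.le_of_one ((hg 1 (c - d)).1 (by simpa using h))
  linarith

theorem HasDeg.single [IsDomain R] (v : G) {r : R} (hr : r ≠ 0) :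
    HasDeg ℓ (single v r) (ℓ v) := fun f c => by
  refine ⟨fun h w hw => ?_, fun h => add_comm c (ℓ v) ▸ (DegLE.single v r).mul h⟩
  have h1 := h (v + w) (by rw [coeff_single_mul_apply]; simp [hr, hw])
  rw [map_add] at h1
  linarith

/-- The top of `f` shifted by `v` cannot be cancelled. The functional `κ` breaks ties, which is what
settles the case `ℓ v = 0`. -/
theorem HasDeg.one_sub_single_of_nonneg (κ : G →+ ℤ) {v : G} (hκ : 0 < κ v) (hv : 0 ≤ ℓ v)
    {u : R} (hu : IsUnit u) : HasDeg ℓ (1 - AddMonoidAlgebra.single v u) (ℓ v) := fun f c => by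
  constructor
  · intro h w hw
    by_contra! hc
    obtain ⟨x, hx, hmax⟩ := f.coeff.support.exists_max_image
      (fun x => toLex (ℓ x, κ x)) ⟨w, Finsupp.mem_support_iff.2 hw⟩
    have hwx : ℓ w ≤ ℓ x := by
      rcases Prod.Lex.le_iff.1 (hmax w (Finsupp.mem_support_iff.2 hw)) with h' | h'
      · exact h'.le
      · exact h'.1.le
    -- `x` is lexicographically maximal for `(ℓ, κ)` on the support and `x + v` is strictly larger,
    -- so the product has coefficient `-u * f.coeff x` at `x + v`.
    have h0 : f.coeff (x + v) = 0 := by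
      by_contra h0
      have := hmax (x + v) (Finsupp.mem_support_iff.2 h0)
      rcases Prod.Lex.le_iff.1 this with h' | h'
      · simp only [ofLex_toLex, map_add] at h'; linarith
      · simp only [ofLex_toLex, map_add] at h'; linarith [h'.2]
    have h1 := h (x + v) (by
      rw [sub_mul, one_mul, coeff_sub, Finsupp.sub_apply, h0, coeff_single_mul_apply]
      simpa [add_comm] using fun h => Finsupp.mem_support_iff.1 hx (hu.mul_right_eq_zero.1 h))
    rw [map_add] at h1
    linarith
  · intro h
    rw [add_comm]
    refine DegLE.mul ?_ h
    rw [sub_eq_add_neg]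
    exact (DegLE.one.mono hv).add (DegLE.single v u).neg

theorem HasDeg.one_sub_single [IsDomain R] (κ : G →+ ℤ) {v : G} (hκ : κ v ≠ 0)
    {u : R} (hu : IsUnit u) :
    HasDeg ℓ (1 - AddMonoidAlgebra.single v u) (max 0 (ℓ v)) := by
  have main : ∀ {w : G} {r : R}, κ w ≠ 0 → IsUnit r → 0 ≤ ℓ w →
      HasDeg ℓ (1 - AddMonoidAlgebra.single w r) (ℓ w) := by
    intro w r hw hr h
    rcases lt_or_gt_of_ne hw with hw | hw
    · exact HasDeg.one_sub_single_of_nonneg (-κ) (by simpa using hw) h hr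
    · exact HasDeg.one_sub_single_of_nonneg κ hw h hr
  rcases le_total 0 (ℓ v) with h | h
  · rw [max_eq_right h]
    exact main hκ hu h
  · rw [max_eq_left h]
    obtain ⟨u, rfl⟩ := hu
    -- For `ℓ v ≤ 0`, factor `1 - u z^v = -u z^v (1 - u⁻¹ z^(-v))`; the degrees `ℓ v` and `-ℓ v`
    -- cancel.
    have h1 := (HasDeg.single (ℓ := ℓ) v (neg_ne_zero.2 u.ne_zero)).mul
      (main (w := -v) (by simpa using hκ) u⁻¹.isUnit (by simpa using h))
    rw [mul_sub, single_mul_single] at h1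
    simpa [one_def, sub_eq_add_neg, add_comm] using h1

end Degree

/-! ### From degree bounds to inclusion of Newton polytopes -/

theorem coeff_toRealExp_mul_single {n : ℕ} (f : LaurentRing n) (s : Fin n → ℝ)
    (v : Fin n → ℝ) :
    (toRealExp f * AddMonoidAlgebra.single s 1).coeff v ≠ 0 ↔
      ∃ w : Fin n → ℤ, f.coeff w ≠ 0 ∧ v = (fun a => (w a : ℝ)) + s := by
  classical
  have hinj : Function.Injective fun (v : Fin n → ℤ) (a : Fin n) => (v a : ℝ) := by
    intro v w h
    ext a
    exact Int.cast_injective (congrFun h a)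
  rw [← Finsupp.mem_support_iff, AddMonoidAlgebra.support_coeff_mul_single _ _ (by simp)]
  simp only [toRealExp, AddMonoidAlgebra.mapDomain, Finset.mem_map, addRightEmbedding_apply]
  rw [Finsupp.mapDomain_support_of_injective hinj]
  simp [eq_comm]

theorem S_eq_single {N n : ℕ} {lam : Fin N → ℕ} (ν : Fin N → ℝ) (I : IndexSet n lam) :
    S ν I = AddMonoidAlgebra.single (fun a => -ν (I.blockOf a)) 1 := by
  have h : S ν I = ∏ a, AddMonoidAlgebra.single (Pi.single a (-ν (I.blockOf a)))
      (1 : LaurentPolynomial ℂ) := by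
    rw [S, ← Finset.prod_fiberwise Finset.univ I.blockOf]
    refine Finset.prod_congr rfl fun k _ => Finset.prod_congr rfl fun a ha => ?_
    simp only [Finset.mem_filter, Finset.mem_univ, true_and] at ha
    rw [ha]
  rw [h, AddMonoidAlgebra.prod_single]
  simp [Finset.univ_sum_single]

/-- The additive functional on integer exponents with the given coefficients. -/
def expFunctional {n : ℕ} (l : Fin n → ℝ) : (Fin n → ℤ) →+ ℝ where
  toFun v := ∑ a, l a * v a
  map_zero' := by simp
  map_add' v w := by simp [mul_add, Finset.sum_add_distrib]

theorem expFunctional_apply {n : ℕ} (l : Fin n → ℝ) (v : Fin n → ℤ) :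
    expFunctional l v = ∑ a, l a * v a := rfl

theorem expFunctional_single {n : ℕ} (l : Fin n → ℝ) (a : Fin n) (m : ℤ) :
    expFunctional l (Pi.single a m) = l a * m := by
  rw [expFunctional_apply, Finset.sum_eq_single a]
  · simp
  · intro b _ hb; simp [hb]
  · simp

/-- An exponent outside the second polytope would be strictly separated from it by some `l`. The
real shifts `s` and `t` are moved into the bounds, so that degrees are only taken of Laurent
polynomials with integer exponents. -/
theorem newtonPolytope_subset {n : ℕ} {f g : LaurentRing n} {s t : Fin n → ℝ}
    (h : ∀ (l : Fin n → ℝ) (c : ℝ), DegLE (expFunctional l) g (c - ∑ a, l a * t a) →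
      DegLE (expFunctional l) f (c - ∑ a, l a * s a)) :
    newtonPolytope (toRealExp f * AddMonoidAlgebra.single s 1) ⊆
      newtonPolytope (toRealExp g * AddMonoidAlgebra.single t 1) := by
  refine convexHull_min (fun v hv => ?_) (convex_convexHull ℝ _)
  by_contra hv'
  -- Finiteness makes the convex hull closed, as the separation theorem requires.
  have hfin : {v | (toRealExp g * AddMonoidAlgebra.single t 1).coeff v ≠ 0}.Finite :=
    (toRealExp g * AddMonoidAlgebra.single t 1).coeff.hasFiniteSupport
  obtain ⟨L, u, hL, hu⟩ := geometric_hahn_banach_closed_point (convex_convexHull ℝ _)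
    (hfin.isClosed_convexHull ℝ) hv'
  have hLs : ∀ x : Fin n → ℝ, L x = ∑ a, L (Pi.single a 1) * x a := by
    intro x
    conv_lhs => rw [← Finset.univ_sum_single x]
    rw [map_sum]
    refine Finset.sum_congr rfl fun a _ => ?_
    rw [mul_comm, ← smul_eq_mul, ← map_smul]
    congr 1
    ext b
    simp [Pi.single_apply]
  obtain ⟨w, hw, rfl⟩ := (coeff_toRealExp_mul_single f s v).1 hv
  have hf := h (fun a => L (Pi.single a 1)) u (fun x hx => by
    have := hL _ (subset_convexHull ℝ _ ((coeff_toRealExp_mul_single g t _).2 ⟨x, hx, rfl⟩))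
    rw [map_add, hLs, hLs t] at this
    rw [expFunctional_apply]
    linarith) w hw
  rw [map_add, hLs, hLs s] at hu
  rw [expFunctional_apply] at hf
  linarith

/-! ### Clearing denominators in the weight function -/

section Numerators

variable {N n : ℕ} {lam : Fin N → ℕ}

theorem IndexSet.enum_injective (I : IndexSet n lam) (k : ℕ) : Function.Injective (I.enum k) :=
  (Finset.orderEmbOfFin _ _).injective

/-- The variable `z_a` as a unit of the ring of Laurent polynomials. -/
noncomputable def zUnit (a : Fin n) : (LaurentRing n)ˣ where
  val := AddMonoidAlgebra.single (Pi.single a 1) 1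
  inv := AddMonoidAlgebra.single (-Pi.single a 1) 1
  val_inv := by
    rw [AddMonoidAlgebra.single_mul_single, add_neg_cancel, one_mul]
    rfl
  inv_val := by
    rw [AddMonoidAlgebra.single_mul_single, neg_add_cancel, one_mul]
    rfl

theorem val_zUnit_div_zpow (p q : Fin n) (m : ℤ) :
    (((zUnit q / zUnit p) ^ m : (LaurentRing n)ˣ) : LaurentRing n) =
      AddMonoidAlgebra.single (m • (Pi.single q 1 - Pi.single p 1)) 1 := by
  have h1 : ((zUnit q / zUnit p : (LaurentRing n)ˣ) : LaurentRing n) =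
      AddMonoidAlgebra.single (Pi.single q 1 - Pi.single p 1) 1 := by
    rw [div_eq_mul_inv, Units.val_mul]
    simp [zUnit, AddMonoidAlgebra.single_mul_single, sub_eq_add_neg]
  have h2 : (((zUnit q / zUnit p)⁻¹ : (LaurentRing n)ˣ) : LaurentRing n) =
      AddMonoidAlgebra.single (-(Pi.single q 1 - Pi.single p 1)) 1 := by
    rw [inv_div, div_eq_mul_inv, Units.val_mul]
    simp [zUnit, AddMonoidAlgebra.single_mul_single, sub_eq_add_neg]
  cases m with
  | ofNat m =>
    rw [Int.ofNat_eq_natCast, zpow_natCast, Units.val_pow_eq_pow_val, h1,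
      AddMonoidAlgebra.single_pow, one_pow, natCast_zsmul]
  | negSucc m =>
    rw [zpow_negSucc, ← inv_pow, Units.val_pow_eq_pow_val, h2,
      AddMonoidAlgebra.single_pow, one_pow, negSucc_zsmul, smul_neg]

theorem val_zUnit_div (p q : Fin n) :
    ((zUnit q / zUnit p : (LaurentRing n)ˣ) : LaurentRing n) =
      AddMonoidAlgebra.single (Pi.single q 1 - Pi.single p 1) 1 := by
  simpa using val_zUnit_div_zpow p q 1

theorem zUnit_injective : Function.Injective fun a : Fin n => (zUnit a : LaurentRing n) := by
  intro a b h
  have := AddMonoidAlgebra.single_left_injective (one_ne_zero (α := LaurentPolynomial ℂ)) h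
  by_contra hab
  simpa [hab] using congrFun this a

theorem algebraMap_units_zpow (u : (LaurentRing n)ˣ) (m : ℤ) :
    algebraMap (LaurentRing n) (RatFun n) ((u ^ m : (LaurentRing n)ˣ) : LaurentRing n) =
      algebraMap (LaurentRing n) (RatFun n) u ^ m := by
  have := Units.val_zpow_eq_zpow_val
    (Units.map (algebraMap (LaurentRing n) (RatFun n)).toMonoidHom u) m
  rw [← map_zpow] at this
  exact this

theorem algebraMap_zUnit_div (p q : Fin n) :
    algebraMap (LaurentRing n) (RatFun n) ((zUnit q / zUnit p : (LaurentRing n)ˣ) :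
      LaurentRing n) = zVar q / zVar p := by
  rw [div_eq_mul_inv, Units.val_mul, map_mul, ← zpow_neg_one (zUnit p), algebraMap_units_zpow,
    zpow_neg_one, ← div_eq_mul_inv]
  rfl

/-- The variable `h` as a Laurent polynomial. -/
noncomputable def hLaurent (n : ℕ) : LaurentRing n :=
  AddMonoidAlgebra.single 0 (LaurentPolynomial.T 1)

/-- The permutation of the variables at level `k`, trivial for `k ≥ N`. -/
def levelPerm (s : (k : Fin N) → Equiv.Perm (Fin (partialSum lam k))) (k : ℕ) :
    Equiv.Perm (Fin (partialSum lam k)) :=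
  if hk : k < N then s ⟨k, hk⟩ else 1

theorem levelPerm_val (s : (k : Fin N) → Equiv.Perm (Fin (partialSum lam k))) (k : Fin N) :
    levelPerm s k = s k := by
  simp [levelPerm]

theorem levelPerm_of_le (s : (k : Fin N) → Equiv.Perm (Fin (partialSum lam k))) {k : ℕ}
    (hk : N ≤ k) : levelPerm s k = 1 := by
  simp [levelPerm, hk]

theorem levelPerm_one (k : ℕ) :
    levelPerm (1 : (k : Fin N) → Equiv.Perm (Fin (partialSum lam k))) k = 1 := by
  simp [levelPerm]

/-- The index of the variable `z` substituted for `t^{(k)}_a` after permutation by `s`. -/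
def IndexSet.permEnum (J : IndexSet n lam)
    (s : (k : Fin N) → Equiv.Perm (Fin (partialSum lam k))) (k : ℕ)
    (a : Fin (partialSum lam k)) : Fin n :=
  J.enum k (levelPerm s k a)

theorem IndexSet.permEnum_injective (J : IndexSet n lam)
    (s : (k : Fin N) → Equiv.Perm (Fin (partialSum lam k))) (k : ℕ) :
    Function.Injective (J.permEnum s k) :=
  (J.enum_injective k).comp (Equiv.injective _)

theorem IndexSet.permEnum_one (J : IndexSet n lam) (k : ℕ) (a : Fin (partialSum lam k)) :
    J.permEnum 1 k a = J.enum k a := by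
  rw [permEnum, levelPerm_one, Equiv.Perm.one_apply]

theorem permute_zVar (J : IndexSet n lam)
    (s : (k : Fin N) → Equiv.Perm (Fin (partialSum lam k))) (k : ℕ)
    (a : Fin (partialSum lam k)) :
    permute s (fun k a => zVar (J.enum k a)) k a = zVar (J.permEnum s k a) := by
  unfold permute IndexSet.permEnum levelPerm
  split_ifs <;> rfl

/-- The factor `ψ^Δ_{I,k,a,c}` as a Laurent polynomial. -/
noncomputable def psiLaurent (Δ : Set (Fin N → ℝ)) (I : IndexSet n lam) (k : Fin N)
    (a : Fin (partialSum lam k)) (c : Fin (partialSum lam (k.val + 1))) (x : (LaurentRing n)ˣ) :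
    LaurentRing n :=
  if I.enum (k.val + 1) c < I.enum k a then 1 - hLaurent n * x
  else if I.enum (k.val + 1) c = I.enum k a then
    ((x ^ (-intChar Δ (I.blockOf (I.enum k a)) k) : (LaurentRing n)ˣ) : LaurentRing n)
  else 1 - x

theorem algebraMap_psiLaurent (Δ : Set (Fin N → ℝ)) (I : IndexSet n lam) (k : Fin N)
    (a : Fin (partialSum lam k)) (c : Fin (partialSum lam (k.val + 1))) (x : (LaurentRing n)ˣ) :
    algebraMap (LaurentRing n) (RatFun n) (psiLaurent Δ I k a c x) =
      psi Δ (hVar n) I k a c (algebraMap (LaurentRing n) (RatFun n) x) := by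
  unfold psiLaurent psi
  split_ifs
  · rw [map_sub, map_mul, map_one]; rfl
  · exact algebraMap_units_zpow _ _
  · rw [map_sub, map_one]

/-- The numerator of the term of `W^Δ_I(z_J, z, h)` given by the permutations `s`. -/
noncomputable def numTerm (Δ : Set (Fin N → ℝ)) (I J : IndexSet n lam)
    (s : (k : Fin N) → Equiv.Perm (Fin (partialSum lam k))) : LaurentRing n :=
  ∏ k : Fin N, ∏ a : Fin (partialSum lam k),
    ((∏ c : Fin (partialSum lam (k.val + 1)),
      psiLaurent Δ I k a c (zUnit (J.permEnum s (k.val + 1) c) / zUnit (J.permEnum s k a))) *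
      ∏ b ∈ Finset.univ.filter (fun b => a < b), (1 - hLaurent n *
        ((zUnit (J.permEnum s k b) / zUnit (J.permEnum s k a) : (LaurentRing n)ˣ) :
          LaurentRing n)))

/-- The denominator of the term of `W^Δ_I(z_J, z, h)` given by the permutations `s`. -/
noncomputable def denTerm (J : IndexSet n lam)
    (s : (k : Fin N) → Equiv.Perm (Fin (partialSum lam k))) : LaurentRing n :=
  ∏ k : Fin N, ∏ a : Fin (partialSum lam k), ∏ b ∈ Finset.univ.filter (fun b => a < b),
    (1 - ((zUnit (J.permEnum s k b) / zUnit (J.permEnum s k a) : (LaurentRing n)ˣ) :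
      LaurentRing n))

theorem U_eq_div (Δ : Set (Fin N → ℝ)) (I J : IndexSet n lam)
    (s : (k : Fin N) → Equiv.Perm (Fin (partialSum lam k))) :
    U Δ (hVar n) I (permute s fun k a => zVar (J.enum k a)) =
      algebraMap (LaurentRing n) (RatFun n) (numTerm Δ I J s) /
        algebraMap (LaurentRing n) (RatFun n) (denTerm J s) := by
  have hh : algebraMap (LaurentRing n) (RatFun n) (hLaurent n) = hVar n := rfl
  simp only [U, numTerm, denTerm, permute_zVar, map_prod, map_mul, map_sub, map_one,
    algebraMap_psiLaurent, algebraMap_zUnit_div, Finset.prod_div_distrib, hh, Finset.prod_mul_distrib, mul_div_assoc]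

/-- The monomial clearing the inverse powers of `z` in `denTerm`. -/
noncomputable def monTerm (J : IndexSet n lam)
    (s : (k : Fin N) → Equiv.Perm (Fin (partialSum lam k))) : LaurentRing n :=
  ∏ k : Fin N, ∏ a : Fin (partialSum lam k), ∏ _b ∈ Finset.univ.filter (fun b => a < b),
    (-zUnit (J.permEnum s k a) : LaurentRing n)

/-- The product of the signs of the permutations. -/
noncomputable def signTerm (n : ℕ) (s : (k : Fin N) → Equiv.Perm (Fin (partialSum lam k))) :
    LaurentRing n :=
  ∏ k, ((Equiv.Perm.sign (s k) : ℤ) : LaurentRing n)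

/-- The product of the Vandermonde determinants of all levels. -/
noncomputable def vandermondeProd (J : IndexSet n lam) : LaurentRing n :=
  ∏ k : Fin N, (Matrix.vandermonde fun a => (zUnit (J.enum k a) : LaurentRing n)).det

theorem signTerm_mul_self (s : (k : Fin N) → Equiv.Perm (Fin (partialSum lam k))) :
    signTerm n s * signTerm n s = 1 := by
  rw [signTerm, ← Finset.prod_mul_distrib]
  refine Finset.prod_eq_one fun k _ => ?_
  rw [← Int.cast_mul, ← Units.val_mul, Int.units_mul_self, Units.val_one, Int.cast_one]

theorem val_mul_val_div {A : Type*} [CommRing A] (u v : Aˣ) :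
    (u : A) * ((v / u : Aˣ) : A) = v := by
  rw [← Units.val_mul, mul_div_cancel]

theorem neg_mul_one_sub {A : Type*} [CommRing A] {x y r : A} (h : x * r = y) :
    -x * (1 - r) = y - x := by
  rw [← h]
  ring

/-- Each `-z_a (1 - z_b / z_a)` equals `z_b - z_a`, and permuting the rows of a Vandermonde matrix
costs the sign. The right side is free of `s`, so it serves as a common denominator. -/
theorem signTerm_mul_monTerm_mul_denTerm (J : IndexSet n lam)
    (s : (k : Fin N) → Equiv.Perm (Fin (partialSum lam k))) :
    signTerm n s * monTerm J s * denTerm J s = vandermondeProd J := by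
  have h : monTerm J s * denTerm J s = signTerm n s * vandermondeProd J := by
    rw [monTerm, denTerm, signTerm, vandermondeProd, ← Finset.prod_mul_distrib,
      ← Finset.prod_mul_distrib]
    refine Finset.prod_congr rfl fun k _ => ?_
    rw [← Matrix.det_permute]
    change _ = (Matrix.vandermonde fun a => (zUnit (J.enum k (s k a)) : LaurentRing n)).det
    rw [Matrix.det_vandermonde, ← Finset.prod_mul_distrib]
    refine Finset.prod_congr rfl fun a _ => ?_
    rw [← Finset.prod_mul_distrib, Finset.filter_lt_eq_Ioi]
    refine Finset.prod_congr rfl fun b _ => ?_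
    rw [IndexSet.permEnum, IndexSet.permEnum, levelPerm_val]
    refine neg_mul_one_sub ?_
    exact val_mul_val_div _ _
  rw [mul_assoc, h, ← mul_assoc, signTerm_mul_self, one_mul]

theorem vandermondeProd_ne_zero (J : IndexSet n lam) : vandermondeProd J ≠ 0 :=
  Finset.prod_ne_zero_iff.2 fun k _ => Matrix.det_vandermonde_ne_zero_iff.2
    (zUnit_injective.comp (J.enum_injective k))

theorem denTerm_ne_zero (J : IndexSet n lam)
    (s : (k : Fin N) → Equiv.Perm (Fin (partialSum lam k))) : denTerm J s ≠ 0 :=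
  right_ne_zero_of_mul (signTerm_mul_monTerm_mul_denTerm J s ▸ vandermondeProd_ne_zero J)

theorem permLaurent_prod_mem {A ι κ : Type*} [CommRing A] {m : ι → ℕ}
    {u : ∀ k, Fin (m k) → Aˣ} (t : Finset κ) {f : κ → (∀ k, Equiv.Perm (Fin (m k))) → A}
    (hf : ∀ i ∈ t, (fun s => f i s) ∈ permLaurent u) :
    (fun s => ∏ i ∈ t, f i s) ∈ permLaurent u := by
  have := Subalgebra.prod_mem (permLaurent u) hf
  convert this using 1
  ext s
  simp

theorem permLaurent_zpow_mem {A ι : Type*} [CommRing A] {m : ι → ℕ}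
    {u : ∀ k, Fin (m k) → Aˣ} {x : (∀ k, Equiv.Perm (Fin (m k))) → Aˣ}
    (hx : (fun s => (x s : A)) ∈ permLaurent u)
    (hx' : (fun s => ((x s)⁻¹ : Aˣ).val) ∈ permLaurent u) (e : ℤ) :
    (fun s => (x s ^ e : Aˣ).val) ∈ permLaurent u := by
  cases e with
  | ofNat e =>
    convert pow_mem hx e using 1
    ext s
    simp
  | negSucc e =>
    convert pow_mem hx' (e + 1) using 1
    ext s
    simp [zpow_negSucc]

theorem numTerm_mul_monTerm_mem (Δ : Set (Fin N → ℝ)) (I J : IndexSet n lam) :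
    (fun s => numTerm Δ I J s * monTerm J s) ∈
      permLaurent (fun (k : Fin N) a => zUnit (J.enum k a)) := by
  set P := permLaurent (fun (k : Fin N) a => zUnit (J.enum k a))
  have hc : ∀ x : LaurentRing n, (fun _ => x) ∈ P := fun x => P.algebraMap_mem x
  have hz : ∀ (k : ℕ) (a : Fin (partialSum lam k)),
      (fun s => (zUnit (J.permEnum s k a) : LaurentRing n)) ∈ P := by
    intro k a
    by_cases hk : k < N
    · simpa only [IndexSet.permEnum, levelPerm, hk, dite_true] using
        val_mem_permLaurent (fun (k : Fin N) a => zUnit (J.enum k a)) ⟨k, hk⟩ a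
    -- Variables of level `N` are not permuted, so they count as scalars.
    · simp only [IndexSet.permEnum, levelPerm, hk, dite_false]
      exact hc _
  have hz' : ∀ (k : ℕ) (a : Fin (partialSum lam k)),
      (fun s => ((zUnit (J.permEnum s k a))⁻¹ : (LaurentRing n)ˣ).val) ∈ P := by
    intro k a
    by_cases hk : k < N
    · simpa only [IndexSet.permEnum, levelPerm, hk, dite_true] using
        inv_mem_permLaurent (fun (k : Fin N) a => zUnit (J.enum k a)) ⟨k, hk⟩ a
    · simp only [IndexSet.permEnum, levelPerm, hk, dite_false]
      exact hc _
  have hq : ∀ (k l : ℕ) (a : Fin (partialSum lam k)) (c : Fin (partialSum lam l)),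
      (fun s => (zUnit (J.permEnum s l c) / zUnit (J.permEnum s k a) :
        (LaurentRing n)ˣ).val) ∈ P := by
    intro k l a c
    convert mul_mem (hz l c) (hz' k a) using 1
    ext s
    simp [div_eq_mul_inv]
  refine mul_mem (permLaurent_prod_mem _ fun k _ => permLaurent_prod_mem _ fun a _ => ?_)
    (permLaurent_prod_mem _ fun k _ => permLaurent_prod_mem _ fun a _ =>
      permLaurent_prod_mem _ fun b _ => neg_mem (hz k a))
  refine mul_mem (permLaurent_prod_mem _ fun c _ => ?_) (permLaurent_prod_mem _ fun b _ =>
    sub_mem (hc 1) (mul_mem (hc _) (hq _ _ _ _)))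
  unfold psiLaurent
  split_ifs
  · exact sub_mem (hc 1) (mul_mem (hc _) (hq _ _ _ _))
  · refine permLaurent_zpow_mem (hq _ _ _ _) ?_ _
    simpa only [inv_div] using hq _ _ _ _
  · exact sub_mem (hc 1) (hq _ _ _ _)

/-- The evaluations of the weight functions are Laurent polynomials. -/
theorem exists_laurent_evalW (Δ : Set (Fin N → ℝ)) (I J : IndexSet n lam) :
    ∃ f : LaurentRing n, algebraMap (LaurentRing n) (RatFun n) f = evalW Δ I J ∧
      vandermondeProd J * f = (1 - hLaurent n) ^ (∑ k : Fin N, partialSum lam k) *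
        ∑ s, signTerm n s * monTerm J s * numTerm Δ I J s := by
  obtain ⟨g, hg⟩ := prod_vandermonde_dvd_antisymm _ (numTerm_mul_monTerm_mem Δ I J)
  have hV : algebraMap (LaurentRing n) (RatFun n) (vandermondeProd J) ≠ 0 :=
    (map_ne_zero_iff _ (IsFractionRing.injective _ _)).2 (vandermondeProd_ne_zero J)
  have hg' : ∑ s, signTerm n s * monTerm J s * numTerm Δ I J s = vandermondeProd J * g := by
    rw [vandermondeProd, ← hg]
    exact Finset.sum_congr rfl fun s _ => by rw [signTerm]; ring
  refine ⟨(1 - hLaurent n) ^ (∑ k : Fin N, partialSum lam k) * g, ?_, by rw [hg']; ring⟩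
  have hh : algebraMap (LaurentRing n) (RatFun n) (hLaurent n) = hVar n := rfl
  rw [evalW, W, map_mul, map_pow, map_sub, map_one, hh]
  congr 1
  refine mul_left_cancel₀ hV ?_
  rw [← map_mul, ← hg', map_sum, Finset.mul_sum]
  refine Finset.sum_congr rfl fun s _ => ?_
  have hd : algebraMap (LaurentRing n) (RatFun n) (denTerm J s) ≠ 0 :=
    (map_ne_zero_iff _ (IsFractionRing.injective _ _)).2 (denTerm_ne_zero J s)
  rw [U_eq_div, ← signTerm_mul_monTerm_mul_denTerm J s, map_mul, map_mul (algebraMap _ _) _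
    (denTerm J s)]
  field_simp

end Numerators

/-! ### Combinatorics of the levels: the degree estimate and triangularity -/

section Combinatorics

variable {N n : ℕ} {lam : Fin N → ℕ}

theorem IndexSet.mem_firstBlocks (I : IndexSet n lam) {k : ℕ} {p : Fin n} :
    p ∈ I.firstBlocks k ↔ (I.blockOf p).val < k := by
  simp [firstBlocks]

theorem IndexSet.blockOf_enum_lt (I : IndexSet n lam) (k : ℕ) (a : Fin (partialSum lam k)) :
    (I.blockOf (I.enum k a)).val < k :=
  I.mem_firstBlocks.1 (Finset.orderEmbOfFin_mem _ _ _)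

theorem IndexSet.map_enum (I : IndexSet n lam) (k : ℕ) :
    Finset.univ.map ⟨I.enum k, I.enum_injective k⟩ = I.firstBlocks k := by
  rw [← Finset.map_orderEmbOfFin_univ (I.firstBlocks k) (I.card_firstBlocks k)]
  rfl

theorem IndexSet.exists_enum_eq (I : IndexSet n lam) {k : ℕ} {p : Fin n}
    (hp : (I.blockOf p).val < k) : ∃ a, I.enum k a = p := by
  rw [← I.mem_firstBlocks, ← I.map_enum] at hp
  simpa using hp

theorem IndexSet.sum_enum (I : IndexSet n lam) (k : ℕ) (g : Fin n → ℝ) :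
    ∑ a, g (I.enum k a) = ∑ p, if (I.blockOf p).val < k then g p else 0 := by
  rw [← Finset.sum_filter]
  change _ = ∑ p ∈ I.firstBlocks k, g p
  rw [← I.map_enum, Finset.sum_map]
  rfl

theorem sum_range_ite_lt_sub (g : ℕ → ℝ) {j N : ℕ} (hj : j < N) :
    ∑ k ∈ Finset.range N, (if j < k then g (k + 1) - g k else 0) = g N - g (j + 1) := by
  induction N, Nat.succ_le_of_lt hj using Nat.le_induction with
  | base =>
    rw [sub_self]
    exact Finset.sum_eq_zero fun k hk => if_neg (by have := Finset.mem_range.1 hk; omega)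
  | succ N hN ih => rw [Finset.sum_range_succ, ih hN, if_pos (Nat.lt_of_succ_le hN)]; ring

/-- Summation by parts over the levels. -/
theorem sum_levels_eq (I J : IndexSet n lam) (ν : Fin N → ℝ) (l : Fin n → ℝ)
    (L : ℕ → Fin n → ℝ)
    (hL : ∀ k ≤ N, ∑ p, (if (I.blockOf p).val < k then L k p else 0) =
      ∑ p, if (J.blockOf p).val < k then l p else 0)
    (hN : ∀ p, L N p = l p) :
    ∑ k : Fin N, ∑ p, (if (I.blockOf p).val < k.val then
      (ν k - ν (I.blockOf p)) * (L (k + 1) p - L k p) else 0) =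
      ∑ p, ν (J.blockOf p) * l p - ∑ p, ν (I.blockOf p) * l p := by
  have hsplit : ∀ (K : IndexSet n lam) (g : Fin n → ℝ) (k : Fin N),
      ∑ p, (if (K.blockOf p).val < k.val + 1 then g p else 0) =
      ∑ p, (if (K.blockOf p).val < k.val then g p else 0) +
        ∑ p, (if K.blockOf p = k then g p else 0) := by
    intro K g k
    rw [← Finset.sum_add_distrib]
    refine Finset.sum_congr rfl fun p _ => ?_
    rcases lt_trichotomy (K.blockOf p) k with h | h | h
    · rw [if_pos (Nat.lt_succ_of_lt h), if_pos (show (K.blockOf p).val < k.val from h),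
        if_neg h.ne, add_zero]
    · rw [if_pos (by simp [h]), if_neg (by simp [h]), if_pos h, zero_add]
    · rw [if_neg (by have : k.val < (K.blockOf p).val := h; omega),
        if_neg (by have : k.val < (K.blockOf p).val := h; omega), if_neg h.ne', add_zero]
  have hcollect : ∀ (K : IndexSet n lam) (g : ℕ → Fin n → ℝ),
      ∑ k : Fin N, ν k * ∑ p, (if K.blockOf p = k then g k p else 0) =
        ∑ p, ν (K.blockOf p) * g (K.blockOf p) p := by
    intro K g
    simp_rw [Finset.mul_sum]
    rw [Finset.sum_comm]
    refine Finset.sum_congr rfl fun p _ => ?_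
    simp
  -- This is the difference of the hypothesis `hL` at the levels `k + 1` and `k`, with the `k`-th
  -- blocks split off.
  have hA : ∀ k : Fin N, ∑ p, (if (I.blockOf p).val < k.val then L (k + 1) p - L k p else 0) =
      ∑ p, (if J.blockOf p = k then l p else 0) -
        ∑ p, (if I.blockOf p = k then L (k + 1) p else 0) := by
    intro k
    have h1 := hL k k.isLt.le
    have h2 := hL (k + 1) k.isLt
    rw [hsplit, hsplit, ← h1] at h2
    have h3 : ∑ p, (if (I.blockOf p).val < k.val then L (k + 1) p - L k p else 0) =
        ∑ p, (if (I.blockOf p).val < k.val then L (k + 1) p else 0) -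
          ∑ p, (if (I.blockOf p).val < k.val then L k p else 0) := by
      rw [← Finset.sum_sub_distrib]
      refine Finset.sum_congr rfl fun p _ => ?_
      split_ifs <;> simp
    linarith
  -- For fixed `p` the sum telescopes from the first level above its block up to `N`.
  have hB : ∀ p, ∑ k : Fin N, (if (I.blockOf p).val < k.val then L (k + 1) p - L k p else 0) =
      l p - L (I.blockOf p + 1) p := by
    intro p
    rw [← hN, ← sum_range_ite_lt_sub (fun k => L k p) (I.blockOf p).isLt, Finset.sum_range]
  have h1 : ∑ k : Fin N, ∑ p, (if (I.blockOf p).val < k.val then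
      (ν k - ν (I.blockOf p)) * (L (k + 1) p - L k p) else 0) =
      ∑ k : Fin N, ν k * ∑ p, (if (I.blockOf p).val < k.val then L (k + 1) p - L k p else 0) -
        ∑ p, ν (I.blockOf p) *
          ∑ k : Fin N, (if (I.blockOf p).val < k.val then L (k + 1) p - L k p else 0) := by
    simp_rw [Finset.mul_sum]
    rw [Finset.sum_comm (s := Finset.univ (α := Fin n)), ← Finset.sum_sub_distrib]
    refine Finset.sum_congr rfl fun k _ => ?_
    rw [← Finset.sum_sub_distrib]
    refine Finset.sum_congr rfl fun p _ => ?_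
    split_ifs
    · ring
    · simp
  rw [h1]
  simp_rw [hA, hB, mul_sub, Finset.sum_sub_distrib]
  rw [hcollect J fun _ p => l p, hcollect I fun k p => L (k + 1) p]
  ring

/-- The degree of `1 - u z_q / z_p` in the direction `l`. -/
def posPart (l : Fin n → ℝ) (p q : Fin n) : ℝ := max 0 (l q - l p)

/-- The degree of the factor `ψ^Δ_{I,k,a,c}(z_q / z_p)` in the direction `l`. -/
noncomputable def psiDeg (Δ : Set (Fin N → ℝ)) (l : Fin n → ℝ) (I : IndexSet n lam) (k : Fin N)
    (a : Fin (partialSum lam k)) (c : Fin (partialSum lam (k.val + 1))) (p q : Fin n) : ℝ :=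
  if I.enum (k.val + 1) c = I.enum k a then
    ((-intChar Δ (I.blockOf (I.enum k a)) k : ℤ) : ℝ) * (l q - l p)
  else posPart l p q

/-- The support function of the Newton polytope of `W^Δ_J(z_J, z, h)` in the direction `l`. -/
noncomputable def diagDeg (l : Fin n → ℝ) (J : IndexSet n lam) : ℝ :=
  ∑ k : Fin N, ∑ a, ∑ c, posPart l (J.enum k a) (J.enum (k.val + 1) c)

/-- This is where the alcove enters: with `m` the floor of `x = ν_k - ν_j`, the bound `x ≤ m + 1` is
used when `l q ≥ l p`, and `m ≤ x` when `l q ≤ l p`. -/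
theorem psiDeg_le {Δ : Set (Fin N → ℝ)} (hΔ : IsAlcove Δ) {ν : Fin N → ℝ} (hν : ν ∈ Δ)
    (l : Fin n → ℝ) (I : IndexSet n lam) (k : Fin N)
    (a : Fin (partialSum lam k)) (c : Fin (partialSum lam (k.val + 1))) (p q : Fin n) :
    psiDeg Δ l I k a c p q ≤ posPart l p q -
      if I.enum (k.val + 1) c = I.enum k a then
        (ν k - ν (I.blockOf (I.enum k a))) * (l q - l p) else 0 := by
  unfold psiDeg
  split_ifs with h
  · rw [intChar_eq_floor hΔ hν (show I.blockOf (I.enum k a) < k from I.blockOf_enum_lt k a)]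
    set x := ν k - ν (I.blockOf (I.enum k a))
    have h1 := Int.floor_le x
    have h2 := Int.lt_floor_add_one x
    push_cast
    rcases le_total 0 (l q - l p) with h3 | h3
    · rw [posPart, max_eq_right h3]
      nlinarith
    · rw [posPart, max_eq_left h3]
      nlinarith
  · simp

theorem IndexSet.enum_top_eq (I J : IndexSet n lam) (a : Fin (partialSum lam N)) :
    I.enum N a = J.enum N a :=
  Fin.ext ((I.enum_top a).trans (J.enum_top a).symm)

theorem IndexSet.permEnum_top (J : IndexSet n lam)
    (s : (k : Fin N) → Equiv.Perm (Fin (partialSum lam k))) (a : Fin (partialSum lam N)) :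
    J.permEnum s N a = J.enum N a := by
  rw [permEnum, levelPerm_of_le s le_rfl, Equiv.Perm.one_apply]

theorem sum_psiDeg_le {Δ : Set (Fin N → ℝ)} (hΔ : IsAlcove Δ) {ν : Fin N → ℝ} (hν : ν ∈ Δ)
    (l : Fin n → ℝ) (I J : IndexSet n lam)
    (s : (k : Fin N) → Equiv.Perm (Fin (partialSum lam k))) :
    ∑ k : Fin N, ∑ a, ∑ c,
      psiDeg Δ l I k a c (J.permEnum s k a) (J.permEnum s (k.val + 1) c) ≤
      diagDeg l J + ∑ p, ν (I.blockOf p) * l p - ∑ p, ν (J.blockOf p) * l p := by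
  -- `L k` carries the values of `l` at the substituted variables back to the elements of
  -- `I.firstBlocks k`; the value `0` elsewhere plays no role.
  obtain ⟨L, hL⟩ : ∃ L : ℕ → Fin n → ℝ, ∀ k a, L k (I.enum k a) = l (J.permEnum s k a) :=
    ⟨fun k => Function.extend (I.enum k) (fun a => l (J.permEnum s k a)) 0,
      fun k a => (I.enum_injective k).extend_apply _ _ a⟩
  have h1 : ∑ k : Fin N, ∑ a, ∑ c, posPart l (J.permEnum s k a) (J.permEnum s (k.val + 1) c) =
      diagDeg l J := by
    refine Finset.sum_congr rfl fun k _ => ?_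
    rw [← Equiv.sum_comp (levelPerm s k)
      fun a => ∑ c, posPart l (J.enum k a) (J.enum (k.val + 1) c)]
    refine Finset.sum_congr rfl fun a _ => ?_
    exact Equiv.sum_comp (levelPerm s (k.val + 1))
      fun c => posPart l (J.permEnum s k a) (J.enum (k.val + 1) c)
  have h2 := sum_levels_eq I J ν l L (fun k _ => by
      rw [← I.sum_enum, ← J.sum_enum, ← Equiv.sum_comp (levelPerm s k) fun a => l (J.enum k a)]
      exact Finset.sum_congr rfl fun a _ => hL k a) (fun p => by
      obtain ⟨a, rfl⟩ := I.exists_enum_eq (I.blockOf p).isLt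
      rw [hL, J.permEnum_top, I.enum_top_eq J])
  have h3 : ∑ k : Fin N, ∑ a, ∑ c, (if I.enum (k.val + 1) c = I.enum k a then
        (ν k - ν (I.blockOf (I.enum k a))) *
          (l (J.permEnum s (k.val + 1) c) - l (J.permEnum s k a)) else 0) =
      ∑ k : Fin N, ∑ p, (if (I.blockOf p).val < k.val then
        (ν k - ν (I.blockOf p)) * (L (k + 1) p - L k p) else 0) := by
    refine Finset.sum_congr rfl fun k _ => ?_
    rw [← I.sum_enum]
    refine Finset.sum_congr rfl fun a _ => ?_
    -- Exactly one index `c` of level `k + 1` enumerates the element `I.enum k a`.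
    have h4 := I.sum_enum (k.val + 1) fun q => if q = I.enum k a then
      (ν k - ν (I.blockOf (I.enum k a))) * (L (k + 1) q - L k (I.enum k a)) else 0
    rw [Finset.sum_eq_single (I.enum k a), if_pos ((I.blockOf_enum_lt k a).trans_le
      (Nat.le_succ _)), if_pos rfl] at h4
    · rw [← h4]
      simp only [hL]
    · intro q _ hq; simp [hq]
    · simp
  calc _ ≤ ∑ k : Fin N, ∑ a, ∑ c, (posPart l (J.permEnum s k a) (J.permEnum s (k.val + 1) c) -
        if I.enum (k.val + 1) c = I.enum k a then (ν k - ν (I.blockOf (I.enum k a))) *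
          (l (J.permEnum s (k.val + 1) c) - l (J.permEnum s k a)) else 0) :=
        Finset.sum_le_sum fun k _ => Finset.sum_le_sum fun a _ => Finset.sum_le_sum fun c _ =>
          psiDeg_le hΔ hν l I k a c _ _
    _ = _ := by
        simp only [Finset.sum_sub_distrib]
        rw [h1, h3, h2]
        ring

theorem perm_eq_one_of_apply_le {m : ℕ} {σ : Equiv.Perm (Fin m)} (h : ∀ a, σ a ≤ a) :
    σ = 1 := by
  refine Equiv.ext fun a => ?_
  induction a using WellFoundedLT.induction with
  | ind a ih =>
    by_contra hne
    exact hne (σ.injective (ih (σ a) (lt_of_le_of_ne (h a) hne)))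

/-- Descend from level `N`, where nothing is permuted. If level `k + 1` is unpermuted and `a` is
moved up at level `k`, then the element substituted for `a` reappears at level `k + 1` as some `c`
beyond `J.enum k a`, and its factor is `1 - 1 = 0`. A permutation moving nothing up is the identity.
-/
theorem numTerm_self_eq_zero (Δ : Set (Fin N → ℝ)) (J : IndexSet n lam)
    {s : (k : Fin N) → Equiv.Perm (Fin (partialSum lam k))} (hs : s ≠ 1) :
    numTerm Δ J J s = 0 := by
  by_contra h0
  refine hs ?_
  have key : ∀ j ≤ N, levelPerm s (N - j) = 1 := by
    intro j hj
    induction j with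
    | zero => exact levelPerm_of_le s le_rfl
    | succ j ih =>
      obtain ⟨k, hk, hk'⟩ : ∃ k : Fin N, N - (j + 1) = k.val ∧ N - j = k.val + 1 :=
        ⟨⟨N - (j + 1), by omega⟩, rfl, by simp only; omega⟩
      have ih := ih (by omega)
      rw [hk'] at ih
      rw [hk]
      refine perm_eq_one_of_apply_le fun a => ?_
      by_contra! hlt
      obtain ⟨c, hc⟩ := J.exists_enum_eq
        ((J.blockOf_enum_lt k (levelPerm s k a)).trans (Nat.lt_succ_self _))
      have hlt' : J.enum k a < J.enum (k.val + 1) c := by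
        rw [hc]
        exact (Finset.orderEmbOfFin _ _).strictMono hlt
      refine h0 (Finset.prod_eq_zero (Finset.mem_univ k) (Finset.prod_eq_zero
        (Finset.mem_univ a) (mul_eq_zero_of_left (Finset.prod_eq_zero (Finset.mem_univ c) ?_) _)))
      have hq : J.permEnum s (k.val + 1) c = J.permEnum s k a := by
        rw [IndexSet.permEnum, ih, Equiv.Perm.one_apply, hc, IndexSet.permEnum]
      rw [psiLaurent, if_neg hlt'.not_gt, if_neg hlt'.ne', hq, div_eq_mul_inv,
        mul_inv_cancel, Units.val_one, sub_self]
  funext k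
  have := key (N - k) (Nat.sub_le _ _)
  rw [Nat.sub_sub_self k.isLt.le, levelPerm_val] at this
  exact this

end Combinatorics

/-! ### Degrees of numerators, denominators and weight functions -/

section DegreeBounds

open AddMonoidAlgebra

variable {N n : ℕ} {lam : Fin N → ℕ}

theorem expFunctional_sub_single (l : Fin n → ℝ) (p q : Fin n) :
    expFunctional l (Pi.single q 1 - Pi.single p 1) = l q - l p := by
  rw [map_sub, expFunctional_single, expFunctional_single]
  simp

theorem hLaurent_mul_val_zUnit_div (p q : Fin n) :
    hLaurent n * ((zUnit q / zUnit p : (LaurentRing n)ˣ) : LaurentRing n) =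
      AddMonoidAlgebra.single (Pi.single q 1 - Pi.single p 1) (LaurentPolynomial.T 1) := by
  rw [val_zUnit_div, hLaurent, single_mul_single, zero_add, mul_one]

theorem hasDeg_one_sub_single_sub_single (l : Fin n → ℝ) {p q : Fin n} (hpq : p ≠ q)
    {u : LaurentPolynomial ℂ} (hu : IsUnit u) :
    HasDeg (expFunctional l) (1 - AddMonoidAlgebra.single (Pi.single q 1 - Pi.single p 1) u)
      (posPart l p q) := by
  rw [posPart, ← expFunctional_sub_single]
  refine HasDeg.one_sub_single (Pi.evalAddMonoidHom (fun _ => ℤ) q) ?_ hu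
  simp [hpq.symm]

theorem one_sub_T_ne_zero : (1 - LaurentPolynomial.T 1 : LaurentPolynomial ℂ) ≠ 0 := by
  intro h
  have h' : AddMonoidAlgebra.single (0 : ℤ) (1 : ℂ) = AddMonoidAlgebra.single 1 1 :=
    sub_eq_zero.1 h
  exact zero_ne_one (single_left_injective one_ne_zero h')

theorem hasDeg_one_sub_hLaurent (l : Fin n → ℝ) :
    HasDeg (expFunctional l) (1 - hLaurent n) 0 := by
  have := HasDeg.single (ℓ := expFunctional l) 0 one_sub_T_ne_zero
  rwa [single_sub, map_zero] at this

theorem hasDeg_one_sub_h_mul (l : Fin n → ℝ) (p q : Fin n) :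
    HasDeg (expFunctional l)
      (1 - hLaurent n * ((zUnit q / zUnit p : (LaurentRing n)ˣ) : LaurentRing n))
      (posPart l p q) := by
  rcases eq_or_ne p q with rfl | hpq
  · rw [div_eq_mul_inv, mul_inv_cancel, Units.val_one, mul_one, posPart, sub_self, max_self]
    exact hasDeg_one_sub_hLaurent l
  · rw [hLaurent_mul_val_zUnit_div]
    exact hasDeg_one_sub_single_sub_single l hpq (LaurentPolynomial.isUnit_T 1)

theorem hasDeg_one_sub_zUnit_div (l : Fin n → ℝ) {p q : Fin n} (hpq : p ≠ q) :
    HasDeg (expFunctional l) (1 - ((zUnit q / zUnit p : (LaurentRing n)ˣ) : LaurentRing n))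
      (posPart l p q) := by
  rw [val_zUnit_div]
  exact hasDeg_one_sub_single_sub_single l hpq isUnit_one

theorem hasDeg_zUnit_div_zpow (l : Fin n → ℝ) (p q : Fin n) (m : ℤ) :
    HasDeg (expFunctional l) (((zUnit q / zUnit p) ^ m : (LaurentRing n)ˣ) : LaurentRing n)
      (m * (l q - l p)) := by
  rw [val_zUnit_div_zpow]
  convert HasDeg.single (ℓ := expFunctional l) _ (one_ne_zero (α := LaurentPolynomial ℂ)) using 1
  rw [map_zsmul, expFunctional_sub_single, zsmul_eq_mul]

theorem degLE_psiLaurent (Δ : Set (Fin N → ℝ)) (l : Fin n → ℝ) (I : IndexSet n lam) (k : Fin N)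
    (a : Fin (partialSum lam k)) (c : Fin (partialSum lam (k.val + 1))) (p q : Fin n) :
    DegLE (expFunctional l) (psiLaurent Δ I k a c (zUnit q / zUnit p))
      (psiDeg Δ l I k a c p q) := by
  unfold psiLaurent psiDeg
  split_ifs with h1 h2 h2
  · exact absurd h2 h1.ne
  · exact (hasDeg_one_sub_h_mul l p q).degLE
  · exact (hasDeg_zUnit_div_zpow l p q _).degLE
  · rcases eq_or_ne p q with rfl | hpq
    · rw [div_eq_mul_inv, mul_inv_cancel, Units.val_one, sub_self]
      exact DegLE.zero _
    · exact (hasDeg_one_sub_zUnit_div l hpq).degLE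

/-- On the diagonal the monomial factor is evaluated at `1`, so the integers of the alcove
disappear, and no factor `1 - x` vanishes. -/
theorem hasDeg_psiLaurent_self (Δ : Set (Fin N → ℝ)) (l : Fin n → ℝ) (I : IndexSet n lam)
    (k : Fin N) (a : Fin (partialSum lam k)) (c : Fin (partialSum lam (k.val + 1))) :
    HasDeg (expFunctional l)
      (psiLaurent Δ I k a c (zUnit (I.enum (k.val + 1) c) / zUnit (I.enum k a)))
      (posPart l (I.enum k a) (I.enum (k.val + 1) c)) := by
  unfold psiLaurent
  split_ifs with h1 h2
  · exact hasDeg_one_sub_h_mul l _ _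
  · convert hasDeg_zUnit_div_zpow l _ _ _ using 1
    rw [h2, posPart, sub_self, max_self, mul_zero]
  · exact hasDeg_one_sub_zUnit_div l (Ne.symm h2)

/-- The degree of `denTerm` in the direction `l`. -/
noncomputable def denDeg (l : Fin n → ℝ) (J : IndexSet n lam)
    (s : (k : Fin N) → Equiv.Perm (Fin (partialSum lam k))) : ℝ :=
  ∑ k : Fin N, ∑ a, ∑ b ∈ Finset.univ.filter (fun b => a < b),
    posPart l (J.permEnum s k a) (J.permEnum s k b)

theorem hasDeg_denTerm (l : Fin n → ℝ) (J : IndexSet n lam)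
    (s : (k : Fin N) → Equiv.Perm (Fin (partialSum lam k))) :
    HasDeg (expFunctional l) (denTerm J s) (denDeg l J s) :=
  HasDeg.prod _ fun k _ => HasDeg.prod _ fun _ _ => HasDeg.prod _ fun _ hb =>
    hasDeg_one_sub_zUnit_div l
      ((J.permEnum_injective s k).ne (Finset.mem_filter.1 hb).2.ne)

/-- The `h`-binomials within a level have the degrees of the corresponding factors of `denTerm`,
whence the summand `denDeg`, which cancels later. -/
theorem degLE_numTerm (Δ : Set (Fin N → ℝ)) (l : Fin n → ℝ) (I J : IndexSet n lam)
    (s : (k : Fin N) → Equiv.Perm (Fin (partialSum lam k))) :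
    DegLE (expFunctional l) (numTerm Δ I J s) ((∑ k : Fin N, ∑ a, ∑ c,
      psiDeg Δ l I k a c (J.permEnum s k a) (J.permEnum s (k.val + 1) c)) + denDeg l J s) := by
  simp only [denDeg, ← Finset.sum_add_distrib]
  exact DegLE.prod _ fun k _ => DegLE.prod _ fun a _ =>
    (DegLE.prod _ fun c _ => degLE_psiLaurent Δ l I k a c _ _).mul
      (DegLE.prod _ fun b _ => (hasDeg_one_sub_h_mul l _ _).degLE)

theorem hasDeg_numTerm_self (Δ : Set (Fin N → ℝ)) (l : Fin n → ℝ) (J : IndexSet n lam) :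
    HasDeg (expFunctional l) (numTerm Δ J J 1) (diagDeg l J + denDeg l J 1) := by
  simp only [denDeg, diagDeg, ← Finset.sum_add_distrib, numTerm, IndexSet.permEnum_one]
  exact HasDeg.prod _ fun k _ => HasDeg.prod _ fun a _ =>
    (HasDeg.prod _ fun c _ => hasDeg_psiLaurent_self Δ l J k a c).mul
      (HasDeg.prod _ fun b _ => hasDeg_one_sub_h_mul l _ _)

theorem exists_hasDeg_signTerm_mul_monTerm (l : Fin n → ℝ) (J : IndexSet n lam)
    (s : (k : Fin N) → Equiv.Perm (Fin (partialSum lam k))) :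
    ∃ d, HasDeg (expFunctional l) (signTerm n s * monTerm J s) d := by
  refine ⟨(∑ k : Fin N, 0) + ∑ k : Fin N, ∑ a,
    ∑ _b ∈ Finset.univ.filter (fun b => a < b), l (J.permEnum s k a), ?_⟩
  refine HasDeg.mul (HasDeg.prod _ fun k _ => ?_) (HasDeg.prod _ fun k _ =>
    HasDeg.prod _ fun a _ => HasDeg.prod _ fun b _ => ?_)
  · rcases Int.units_eq_one_or (Equiv.Perm.sign (s k)) with h | h
    · rw [h, Units.val_one, Int.cast_one]
      exact HasDeg.one
    · have := HasDeg.single (ℓ := expFunctional l) 0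
        (neg_ne_zero.2 (one_ne_zero (α := LaurentPolynomial ℂ)))
      rw [single_neg, map_zero] at this
      rw [h, Units.val_neg, Units.val_one, Int.cast_neg, Int.cast_one]
      exact this
  · have := HasDeg.single (ℓ := expFunctional l) (Pi.single (J.permEnum s k a) 1)
      (neg_ne_zero.2 (one_ne_zero (α := LaurentPolynomial ℂ)))
    rw [single_neg, expFunctional_single, Int.cast_one, mul_one] at this
    exact this

theorem HasDeg.unique {R G : Type*} [CommRing R] [Nontrivial R] [AddCommGroup G] {ℓ : G →+ ℝ}
    {g : AddMonoidAlgebra R G} {c d : ℝ} (hc : HasDeg ℓ g c) (hd : HasDeg ℓ g d) : c = d :=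
  le_antisymm (hc.le_of_degLE hd.degLE) (hd.le_of_degLE hc.degLE)

/-- The degree of `W^Δ_I(z_J, z, h)` is bounded, with equality for `I = J`. -/
theorem degLE_of_vandermondeProd_mul {Δ : Set (Fin N → ℝ)} (hΔ : IsAlcove Δ) {ν : Fin N → ℝ}
    (hν : ν ∈ Δ) (l : Fin n → ℝ) {I J : IndexSet n lam} {f : LaurentRing n}
    (hf : vandermondeProd J * f = (1 - hLaurent n) ^ (∑ k : Fin N, partialSum lam k) *
        ∑ s, signTerm n s * monTerm J s * numTerm Δ I J s) :
    DegLE (expFunctional l) f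
      (diagDeg l J + ∑ p, ν (I.blockOf p) * l p - ∑ p, ν (J.blockOf p) * l p) := by
  choose e he using exists_hasDeg_signTerm_mul_monTerm (lam := lam) l J
  have hV : ∀ s, HasDeg (expFunctional l) (vandermondeProd J) (e s + denDeg l J s) := fun s =>
    signTerm_mul_monTerm_mul_denTerm J s ▸ (he s).mul (hasDeg_denTerm l J s)
  refine (hV 1 _ _).1 ?_
  rw [hf, ← add_zero (_ + (e 1 + denDeg l J 1)), add_comm _ (0 : ℝ)]
  refine ((hasDeg_one_sub_hLaurent l).pow _).degLE.mul (DegLE.sum _ fun s _ => ?_)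
  refine ((he s).degLE.mul (degLE_numTerm Δ l I J s)).mono ?_
  -- The Vandermonde product has a single degree, so `e s + denDeg l J s` does not depend on `s` and
  -- all terms can be compared.
  rw [(hV 1).unique (hV s)]
  linarith [sum_psiDeg_le hΔ hν l I J s]

theorem diagDeg_le_of_vandermondeProd_mul {Δ : Set (Fin N → ℝ)} {l : Fin n → ℝ}
    {J : IndexSet n lam} {f : LaurentRing n} {c : ℝ}
    (hf : vandermondeProd J * f = (1 - hLaurent n) ^ (∑ k : Fin N, partialSum lam k) *
        ∑ s, signTerm n s * monTerm J s * numTerm Δ J J s)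
    (hc : DegLE (expFunctional l) f c) : diagDeg l J ≤ c := by
  obtain ⟨e, he⟩ := exists_hasDeg_signTerm_mul_monTerm (lam := lam) l J 1
  have hV : HasDeg (expFunctional l) (vandermondeProd J) (e + denDeg l J 1) :=
    signTerm_mul_monTerm_mul_denTerm J 1 ▸ he.mul (hasDeg_denTerm l J 1)
  have hsum : ∑ s, signTerm n s * monTerm J s * numTerm Δ J J s =
      signTerm n 1 * monTerm J 1 * numTerm Δ J J 1 :=
    Finset.sum_eq_single_of_mem 1 (Finset.mem_univ _) fun s _ hs => by
      rw [numTerm_self_eq_zero Δ J hs, mul_zero]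
  have h1 := (hV f c).2 hc
  rw [hf, hsum] at h1
  have h2 := (((hasDeg_one_sub_hLaurent l).pow _).mul
    (he.mul (hasDeg_numTerm_self Δ l J))).le_of_degLE h1
  linarith

end DegreeBounds

end TrigWeight

/-- Each evaluation `W^Δ_I(z_J, z, h)` is a Laurent polynomial `f I J` (unique, as Laurent
polynomials embed into rational functions), and the Newton polytope of `f I J * S_I` lies in that
of `f J J * S_J`. -/
theorem theorem3p7 {N n : ℕ} (lam : Fin N → ℕ) (hlam : ∑ k, lam k = n)
    (Δ : Set (Fin N → ℝ)) (hΔ : TrigWeight.IsAlcove Δ) (ν : Fin N → ℝ) (hν : ν ∈ Δ) :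
    ∃ f : TrigWeight.IndexSet n lam → TrigWeight.IndexSet n lam → TrigWeight.LaurentRing n,
      (∀ I J, algebraMap (TrigWeight.LaurentRing n) (TrigWeight.RatFun n) (f I J) =
        TrigWeight.evalW Δ I J) ∧
      ∀ I J, TrigWeight.newtonPolytope (TrigWeight.toRealExp (f I J) * TrigWeight.S ν I) ⊆
        TrigWeight.newtonPolytope (TrigWeight.toRealExp (f J J) * TrigWeight.S ν J) := by
  choose f hf hmul using TrigWeight.exists_laurent_evalW (n := n) (lam := lam) Δ
  refine ⟨f, hf, fun I J => ?_⟩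
  rw [TrigWeight.S_eq_single, TrigWeight.S_eq_single]
  refine TrigWeight.newtonPolytope_subset fun l c hc => ?_
  -- Sharpness on the diagonal turns the bound on `f J J` into one on `diagDeg l J`, which controls
  -- `f I J`.
  have h1 := TrigWeight.diagDeg_le_of_vandermondeProd_mul (hmul J J) hc
  refine (TrigWeight.degLE_of_vandermondeProd_mul hΔ hν l (hmul I J)).mono ?_
  simp only [mul_comm (l _), neg_mul, Finset.sum_neg_distrib] at h1 ⊢
  linarith
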